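/- Let $a>0$, $0<b<1$ and $\mathcal I=\dfrac{1-b}{\sqrt{b(a+b)}}$. Consider the reduced equations of a free rigid body $$\frac{d\psi}{d\phi}=\frac{(a+b\cos^2\psi)\cos\theta}{1-b\cos^2\psi},\qquad \frac{d\theta}{d\phi}=\frac{b\sin\theta\sin\psi\cos\psi}{1-b\cos^2\psi},$$ which have the first integral $c=a-\sin^2\theta\,(a+b\cos^2\psi)$. Let $\mathcal C$ be the set of pairs $(c,\varepsilon)$ for which some solution $(\psi,\theta)$ on $-\pi\le\phi\le\pi$, with value $c$ of the first integral, satisfies $\psi(-\pi)=-\frac{\pi}{2}+\varepsilon$ and $\psi(\pi)=\frac{\pi}{2}-\varepsilon$ (so that $\Delta\phi=2\pi$) and passes half-way through $\psi(0)=0$ with $\cos\theta(0)>0$. (This set is the graph of a function of $c$; $\varepsilon(c)=e$ means $(c,e)\in\mathcal C$.) Let $\mathcal S=\{(c,\varepsilon) : c=-b\sin^2\varepsilon\}$, and number the points of $\mathcal C\cap\mathcal S$ by decreasing $c$. For every integer $n\ge 1$, if $\mathcal I<\frac{2}{2n+1}$, then $\mathcal C$ and $\mathcal S$ have at least $n$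 intersection points, and there is an $n$-th one. Moreover, if $(c_n,\varepsilon(c_n))$ is the $n$-th intersection point, then there exist $c^*\in(-b,c_n)$ with $\varepsilon(c^*)=\frac{\pi}{2}$ and another intersection point $(c_{int},\varepsilon(c_{int}))$ with $c_{int}\in(-b,c_n)$. -/

import Mathlib

namespace TennisRacket

/-- The geometric constant `𝓘(a, b) = (1 - b) / √(b (a + b))`. -/
noncomputable def geometricConstant (a b : ℝ) : ℝ :=
  (1 - b) / Real.sqrt (b * (a + b))

/-- `(ψ, θ)` solves, for `φ ∈ [-π, π]`, the reduced equations of a free rigid body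
with asymmetry parameters `a, b` (the angle `φ` plays the role of time). -/
def IsReducedSolution (a b : ℝ) (ψ θ : ℝ → ℝ) : Prop :=
  ∀ φ ∈ Set.Icc (-Real.pi) Real.pi,
    HasDerivWithinAt ψ
      ((a + b * Real.cos (ψ φ) ^ 2) * Real.cos (θ φ) / (1 - b * Real.cos (ψ φ) ^ 2))
      (Set.Icc (-Real.pi) Real.pi) φ ∧
    HasDerivWithinAt θ
      (b * Real.sin (θ φ) * Real.sin (ψ φ) * Real.cos (ψ φ) / (1 - b * Real.cos (ψ φ) ^ 2))
      (Set.Icc (-Real.pi) Real.pi) φ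

/-- The value `a - sin² θ (a + b cos² ψ)` of the first integral of the reduced system. -/
noncomputable def firstIntegral (a b ψ θ : ℝ) : ℝ :=
  a - Real.sin θ ^ 2 * (a + b * Real.cos ψ ^ 2)

/-- The curve `𝓒` of pairs `(c, ε)` such that the trajectory at level `c` goes from
`ψ = -π/2 + ε` to `ψ = π/2 - ε` while `φ` increases by `2π` (here from `-π` to `π`).
The branch of `cos θ` is fixed at half-way: by the reflection `(φ, ψ, θ) ↦ (-φ, -ψ, θ)` a
trajectory with symmetric end points is at `ψ = 0` there, and the trajectory considered is the one
with `cos θ > 0` at that moment (the other sign gives the mirror image `ε ↦ π - ε`). -/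
def curveC (a b : ℝ) : Set (ℝ × ℝ) :=
  {p | ∃ ψ θ : ℝ → ℝ,
    IsReducedSolution a b ψ θ ∧
    (∀ φ ∈ Set.Icc (-Real.pi) Real.pi, firstIntegral a b (ψ φ) (θ φ) = p.1) ∧
    ψ (-Real.pi) = -(Real.pi / 2) + p.2 ∧
    ψ Real.pi = Real.pi / 2 - p.2 ∧
    ψ 0 = 0 ∧ 0 < Real.cos (θ 0)}

/-- The curve `𝓢 = {(c, ε) | c = -b sin² ε}`. -/
def curveS (b : ℝ) : Set (ℝ × ℝ) :=
  {p | p.1 = -b * Real.sin p.2 ^ 2}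

/-- `p` is the `n`-th intersection point of `𝓒` and `𝓢`, the points being numbered `1, 2, …` by
decreasing `c`: exactly `n` intersection points (`p` included) have abscissa at least that of
`p`. -/
def IsNthIntersection (a b : ℝ) (n : ℕ) (p : ℝ × ℝ) : Prop :=
  p ∈ curveC a b ∩ curveS b ∧
    {q | q ∈ curveC a b ∩ curveS b ∧ p.1 ≤ q.1}.encard = (n : ℕ∞)

end TennisRacket

namespace TennisRacket

open Set Filter Topology MeasureTheory

/-! For `-b < c < 0` put `c = b (m - 1)` with `0 < m < 1`. The trajectory through `ψ = 0` is then an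
oscillation `sin ψ = √m sin u` whose phase `u` satisfies `dφ/du = timeDensity a b (m sin² u)`. Its
quarter period increases strictly with `m`, from `𝓘 π / 2` at `m = 0` to infinity as `m → 1`.

On `𝓢` the first integral forces `cos θ(π) = 0`: a turning point is reached at time `π`, that is,
`(2 j + 1) * quarterPeriod a b m = π` for some natural `j` (`exists_mem_inter_iff`). Intersection
points thus correspond to the `j` with `π / (2 j + 1) > 𝓘 π / 2`, and decreasing `c` means
increasing `j`, so the `n`-th point has `j = n - 1` (`encard_inter_ge`). The hypothesis on `𝓘`
admits `j = n` as well, which gives the further intersection; the intermediate quarter period `π /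
(2 n)` gives `ψ(π) = 0`, hence `ε = π / 2`. -/

/-! ### Time density and its bounds. -/

/-- The density `dφ / du` of the time with respect to the phase `u` of an oscillating trajectory,
as a function of `y = sin² ψ`. -/
noncomputable def timeDensity (a b y : ℝ) : ℝ :=
  (1 - b + b * y) / (Real.sqrt b * Real.sqrt (a + b - b * y) * Real.sqrt (1 - y))

/-- The time at which the phase `x` is reached, on the trajectory with modulus `m`. -/
noncomputable def phaseTime (a b m x : ℝ) : ℝ :=
  ∫ s in (0 : ℝ)..x, timeDensity a b (m * Real.sin s ^ 2)

/-- A quarter of the period of the oscillation with modulus `m`. -/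
noncomputable def quarterPeriod (a b m : ℝ) : ℝ :=
  phaseTime a b m (Real.pi / 2)

lemma mul_sin_sq_mem_Ico {m : ℝ} (hm : m ∈ Ico (0 : ℝ) 1) (s : ℝ) :
    m * Real.sin s ^ 2 ∈ Ico (0 : ℝ) 1 :=
  ⟨mul_nonneg hm.1 (sq_nonneg _),
    (mul_le_of_le_one_right hm.1 (Real.sin_sq_le_one s)).trans_lt hm.2⟩

lemma continuousOn_timeDensity {a b : ℝ} (ha : 0 < a) (hb0 : 0 < b) :
    ContinuousOn (timeDensity a b) (Ico 0 1) := by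
  unfold timeDensity
  refine ContinuousOn.div (by fun_prop) (by fun_prop) fun y hy => ?_
  have h1 : 0 < 1 - y := by linarith [hy.2]
  have h2 : 0 < a + b - b * y := by nlinarith
  positivity

lemma strictMonoOn_timeDensity {a b : ℝ} (ha : 0 < a) (hb0 : 0 < b) (hb1 : b < 1) :
    StrictMonoOn (timeDensity a b) (Ico 0 1) := by
  intro x hx y hy hxy
  have hx1 : 0 < 1 - x := by linarith [hx.2]
  have hy1 : 0 < 1 - y := by linarith [hy.2]
  have hy2 : 0 < a + b - b * y := by nlinarith
  have hx0 := hx.1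
  have hbxy : b * x < b * y := by gcongr
  have hnum : 0 < 1 - b + b * x := by nlinarith
  unfold timeDensity
  apply div_lt_div₀ (by linarith) _ (by linarith) (by positivity)
  gcongr

lemma timeDensity_zero {a b : ℝ} (hb0 : 0 < b) :
    timeDensity a b 0 = geometricConstant a b := by
  simp [timeDensity, geometricConstant, Real.sqrt_mul hb0.le]

lemma geometricConstant_pos {a b : ℝ} (ha : 0 < a) (hb0 : 0 < b) (hb1 : b < 1) :
    0 < geometricConstant a b := by
  unfold geometricConstant
  have : 0 < 1 - b := by linarith
  positivity

lemma geometricConstant_le_timeDensity {a b y : ℝ} (ha : 0 < a) (hb0 : 0 < b) (hb1 : b < 1)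
    (hy : y ∈ Ico (0 : ℝ) 1) : geometricConstant a b ≤ timeDensity a b y := by
  rw [← timeDensity_zero hb0]
  exact (strictMonoOn_timeDensity ha hb0 hb1).monotoneOn (by simp) hy hy.1

lemma timeDensity_pos {a b y : ℝ} (ha : 0 < a) (hb0 : 0 < b) (hb1 : b < 1)
    (hy : y ∈ Ico (0 : ℝ) 1) : 0 < timeDensity a b y :=
  (geometricConstant_pos ha hb0 hb1).trans_le (geometricConstant_le_timeDensity ha hb0 hb1 hy)

/-- Keeps the singular factor at `y = 1`, the source of the divergence of the quarter period. -/
lemma geometricConstant_div_sqrt_le_timeDensity {a b y : ℝ} (ha : 0 < a) (hb0 : 0 < b)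
    (hb1 : b < 1) (hy : y ∈ Ico (0 : ℝ) 1) :
    geometricConstant a b / Real.sqrt (1 - y) ≤ timeDensity a b y := by
  have h1 : 0 < 1 - y := by linarith [hy.2]
  have h2 : 0 < a + b - b * y := by nlinarith [hy.2]
  have h3 : 0 ≤ b * y := mul_nonneg hb0.le hy.1
  unfold geometricConstant timeDensity
  rw [Real.sqrt_mul hb0.le, div_div]
  apply div_le_div₀ (by linarith) (by linarith) (by positivity)
  gcongr
  linarith

/-! ### Time as a function of the phase, and its inverse. -/

section Modulus

variable {a b m : ℝ}

lemma continuous_timeDensity_comp (ha : 0 < a) (hb0 : 0 < b) (hm : m ∈ Ico (0 : ℝ) 1) :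
    Continuous fun s : ℝ => timeDensity a b (m * Real.sin s ^ 2) :=
  (continuousOn_timeDensity ha hb0).comp_continuous (by fun_prop) (mul_sin_sq_mem_Ico hm)

lemma phaseTime_zero : phaseTime a b m 0 = 0 := by simp [phaseTime]

lemma hasDerivAt_phaseTime (ha : 0 < a) (hb0 : 0 < b) (hm : m ∈ Ico (0 : ℝ) 1) (x : ℝ) :
    HasDerivAt (phaseTime a b m) (timeDensity a b (m * Real.sin x ^ 2)) x :=
  (continuous_timeDensity_comp ha hb0 hm).integral_hasStrictDerivAt 0 x |>.hasDerivAt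

lemma strictMono_phaseTime (ha : 0 < a) (hb0 : 0 < b) (hb1 : b < 1) (hm : m ∈ Ico (0 : ℝ) 1) :
    StrictMono (phaseTime a b m) :=
  strictMono_of_hasDerivAt_pos (hasDerivAt_phaseTime ha hb0 hm)
    fun x => timeDensity_pos ha hb0 hb1 (mul_sin_sq_mem_Ico hm x)

lemma phaseTime_neg (x : ℝ) : phaseTime a b m (-x) = -phaseTime a b m x := by
  have := intervalIntegral.integral_comp_neg (a := 0) (b := x)
    (fun s : ℝ => timeDensity a b (m * Real.sin s ^ 2))
  simp only [Real.sin_neg, neg_sq, neg_zero] at this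
  rw [phaseTime, phaseTime, this, intervalIntegral.integral_symm]

lemma phaseTime_pi (ha : 0 < a) (hb0 : 0 < b) (hm : m ∈ Ico (0 : ℝ) 1) :
    phaseTime a b m Real.pi = 2 * quarterPeriod a b m := by
  have hc := continuous_timeDensity_comp ha hb0 hm
  have h := intervalIntegral.integral_comp_sub_left (a := 0) (b := Real.pi / 2)
    (fun s : ℝ => timeDensity a b (m * Real.sin s ^ 2)) Real.pi
  simp only [Real.sin_pi_sub, sub_zero, sub_half] at h
  rw [quarterPeriod, phaseTime, phaseTime, ← intervalIntegral.integral_add_adjacent_intervals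
    (hc.intervalIntegrable 0 (Real.pi / 2)) (hc.intervalIntegrable (Real.pi / 2) Real.pi), ← h]
  ring

lemma phaseTime_add_pi (ha : 0 < a) (hb0 : 0 < b) (hm : m ∈ Ico (0 : ℝ) 1) (x : ℝ) :
    phaseTime a b m (x + Real.pi) = phaseTime a b m x + 2 * quarterPeriod a b m := by
  have hc := continuous_timeDensity_comp ha hb0 hm
  have hp : Function.Periodic (fun s : ℝ => timeDensity a b (m * Real.sin s ^ 2)) Real.pi := by
    intro s
    simp [Real.sin_add_pi]
  rw [← phaseTime_pi ha hb0 hm, phaseTime, phaseTime, phaseTime,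
    ← intervalIntegral.integral_add_adjacent_intervals (hc.intervalIntegrable 0 x)
    (hc.intervalIntegrable x (x + Real.pi)), hp.intervalIntegral_add_eq x 0, zero_add]

lemma phaseTime_add_nat_mul_pi (ha : 0 < a) (hb0 : 0 < b) (hm : m ∈ Ico (0 : ℝ) 1) (x : ℝ)
    (j : ℕ) :
    phaseTime a b m (x + j * Real.pi) = phaseTime a b m x + 2 * j * quarterPeriod a b m := by
  induction j with
  | zero => simp
  | succ j ih =>
    have : x + ((j + 1 : ℕ) : ℝ) * Real.pi = x + j * Real.pi + Real.pi := by push_cast; ring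
    rw [this, phaseTime_add_pi ha hb0 hm, ih]
    push_cast
    ring

lemma geometricConstant_mul_le_phaseTime (ha : 0 < a) (hb0 : 0 < b) (hb1 : b < 1)
    (hm : m ∈ Ico (0 : ℝ) 1) {x : ℝ} (hx : 0 ≤ x) :
    geometricConstant a b * x ≤ phaseTime a b m x := by
  have h := intervalIntegral.integral_mono_on (μ := volume) hx
    (f := fun _ => geometricConstant a b)
    intervalIntegrable_const ((continuous_timeDensity_comp ha hb0 hm).intervalIntegrable 0 x)
    (fun s _ => geometricConstant_le_timeDensity ha hb0 hb1 (mul_sin_sq_mem_Ico hm s))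
  rw [intervalIntegral.integral_const, sub_zero, smul_eq_mul, mul_comm] at h
  exact h

lemma surjective_phaseTime (ha : 0 < a) (hb0 : 0 < b) (hb1 : b < 1) (hm : m ∈ Ico (0 : ℝ) 1) :
    Function.Surjective (phaseTime a b m) := by
  have hI := geometricConstant_pos ha hb0 hb1
  have htop : Tendsto (phaseTime a b m) atTop atTop :=
    tendsto_atTop_mono' _ (eventually_ge_atTop 0 |>.mono fun x hx =>
      geometricConstant_mul_le_phaseTime ha hb0 hb1 hm hx) (tendsto_id.const_mul_atTop hI)
  have hbot : Tendsto (phaseTime a b m) atBot atBot := by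
    have := tendsto_neg_atTop_atBot.comp (htop.comp tendsto_neg_atBot_atTop)
    refine this.congr fun x => ?_
    simp [phaseTime_neg]
  exact Continuous.surjective
    (continuous_iff_continuousAt.2 fun x => (hasDerivAt_phaseTime ha hb0 hm x).continuousAt)
    htop hbot

/-- The phase of the oscillation with modulus `m` as a function of time. -/
lemma exists_phase (ha : 0 < a) (hb0 : 0 < b) (hb1 : b < 1) (hm : m ∈ Ico (0 : ℝ) 1) :
    ∃ u : ℝ → ℝ, (∀ t, phaseTime a b m (u t) = t) ∧ u 0 = 0 ∧ (∀ t, u (-t) = -u t) ∧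
      ∀ t, HasDerivAt u (timeDensity a b (m * Real.sin (u t) ^ 2))⁻¹ t := by
  have hmono := strictMono_phaseTime ha hb0 hb1 hm
  let e := hmono.orderIsoOfSurjective _ (surjective_phaseTime ha hb0 hb1 hm)
  have he : ∀ t, phaseTime a b m (e.symm t) = t := fun t => e.apply_symm_apply t
  refine ⟨e.symm, he, ?_, fun t => ?_, fun t => ?_⟩
  · apply hmono.injective
    rw [he, phaseTime_zero]
  · apply hmono.injective
    rw [he, phaseTime_neg, he]
  · exact (hasDerivAt_phaseTime ha hb0 hm _).of_local_left_inverse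
      e.symm.continuous.continuousAt
      (timeDensity_pos ha hb0 hb1 (mul_sin_sq_mem_Ico hm _)).ne' (Eventually.of_forall he)

end Modulus

/-! ### Monotonicity, continuity and range of the quarter period. -/

section QuarterPeriod

variable {a b : ℝ}

lemma quarterPeriod_zero (hb0 : 0 < b) :
    quarterPeriod a b 0 = geometricConstant a b * (Real.pi / 2) := by
  simp [quarterPeriod, phaseTime, timeDensity_zero hb0, mul_comm]

lemma strictMonoOn_quarterPeriod (ha : 0 < a) (hb0 : 0 < b) (hb1 : b < 1) :
    StrictMonoOn (quarterPeriod a b) (Ico 0 1) := by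
  intro m hm m' hm' hmm
  have hpi := Real.pi_pos
  refine intervalIntegral.integral_lt_integral_of_continuousOn_of_le_of_exists_lt (by positivity)
    (continuous_timeDensity_comp ha hb0 hm).continuousOn
    (continuous_timeDensity_comp ha hb0 hm').continuousOn
    (fun s _ => (strictMonoOn_timeDensity ha hb0 hb1).monotoneOn (mul_sin_sq_mem_Ico hm s)
      (mul_sin_sq_mem_Ico hm' s) (by gcongr))
    ⟨Real.pi / 2, right_mem_Icc.2 (by positivity), ?_⟩
  exact strictMonoOn_timeDensity ha hb0 hb1 (mul_sin_sq_mem_Ico hm _) (mul_sin_sq_mem_Ico hm' _)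
    (by simpa using hmm)

lemma continuousOn_quarterPeriod (ha : 0 < a) (hb0 : 0 < b) :
    ContinuousOn (quarterPeriod a b) (Ico 0 1) := by
  rw [continuousOn_iff_continuous_domRestrict]
  refine intervalIntegral.continuous_parametric_intervalIntegral_of_continuous'
    (f := fun (m : Ico (0 : ℝ) 1) s => timeDensity a b (m * Real.sin s ^ 2)) ?_ 0 (Real.pi / 2)
  exact (continuousOn_timeDensity ha hb0).comp_continuous (by fun_prop)
    fun p => mul_sin_sq_mem_Ico p.1.2 p.2

/-- Since `cos s ≤ π / 2 - s` in absolute value, `1 - m sin² s = (1 - m) + m cos² s` is at most a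
sum of two squares, hence at most the square of the sum. -/
lemma sqrt_one_sub_mul_sin_sq_le {m s : ℝ} (hm : m ∈ Ico (0 : ℝ) 1) (hs : s ≤ Real.pi / 2) :
    Real.sqrt (1 - m * Real.sin s ^ 2) ≤ Real.sqrt (1 - m) + (Real.pi / 2 - s) := by
  have h1 : 0 ≤ 1 - m := by linarith [hm.2]
  have hs' : 0 ≤ Real.pi / 2 - s := by linarith
  have hcos : Real.cos s ^ 2 ≤ (Real.pi / 2 - s) ^ 2 := by
    rw [← Real.sin_pi_div_two_sub, sq_le_sq, abs_of_nonneg hs']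
    exact Real.abs_sin_le_abs.trans_eq (abs_of_nonneg hs')
  apply Real.sqrt_le_iff.2 ⟨by positivity, ?_⟩
  have h2 := Real.sq_sqrt h1
  have h3 : 0 ≤ Real.sqrt (1 - m) * (Real.pi / 2 - s) := by positivity
  have h4 : m * Real.cos s ^ 2 ≤ Real.cos s ^ 2 :=
    mul_le_of_le_one_left (sq_nonneg _) hm.2.le
  have h5 := Real.sin_sq_add_cos_sq s
  have h6 : m * Real.sin s ^ 2 = m - m * Real.cos s ^ 2 := by
    rw [← mul_one_sub, ← h5]; ring
  nlinarith

lemma geometricConstant_mul_log_le_quarterPeriod (ha : 0 < a) (hb0 : 0 < b) (hb1 : b < 1) {m : ℝ}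
    (hm : m ∈ Ico (0 : ℝ) 1) :
    geometricConstant a b * (-Real.log (Real.sqrt (1 - m))) ≤ quarterPeriod a b m := by
  set δ := Real.sqrt (1 - m) with hδ
  have hδ0 : 0 < δ := Real.sqrt_pos.2 (by linarith [hm.2])
  have hI := geometricConstant_pos ha hb0 hb1
  have hpi := Real.pi_gt_three
  have hpos : ∀ s ∈ uIcc 0 (Real.pi / 2), 0 < δ + (Real.pi / 2 - s) := by
    intro s hs
    rw [uIcc_of_le (by positivity)] at hs
    linarith [hs.2]
  have hcont : ContinuousOn (fun s : ℝ => geometricConstant a b / (δ + (Real.pi / 2 - s)))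
      (uIcc 0 (Real.pi / 2)) :=
    ContinuousOn.div (by fun_prop) (by fun_prop) fun s hs => (hpos s hs).ne'
  have hint : ∫ s in (0 : ℝ)..(Real.pi / 2), geometricConstant a b / (δ + (Real.pi / 2 - s)) =
      geometricConstant a b * (Real.log (δ + Real.pi / 2) - Real.log δ) := by
    rw [intervalIntegral.integral_eq_sub_of_hasDerivAt
      (f := fun s => -(geometricConstant a b * Real.log (δ + (Real.pi / 2 - s))))
      _ hcont.intervalIntegrable]
    · simp only [sub_self, add_zero, sub_zero]
      ring
    · intro s hs
      have := ((((hasDerivAt_id s).const_sub (Real.pi / 2)).const_add δ).log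
        (hpos s hs).ne').const_mul (geometricConstant a b) |>.neg
      refine this.congr_deriv ?_
      simp only [id]
      ring
  have hle := intervalIntegral.integral_mono_on (μ := volume) (by positivity : 0 ≤ Real.pi / 2)
    hcont.intervalIntegrable
    ((continuous_timeDensity_comp ha hb0 hm).intervalIntegrable 0 (Real.pi / 2))
    (fun s hs => ?_)
  · rw [hint] at hle
    refine le_trans ?_ hle
    -- This term can be dropped because `π / 2 > 1`.
    have : 0 ≤ Real.log (δ + Real.pi / 2) := Real.log_nonneg (by linarith)
    gcongr
    linarith
  · have hy := mul_sin_sq_mem_Ico hm s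
    refine le_trans ?_ (geometricConstant_div_sqrt_le_timeDensity ha hb0 hb1 hy)
    have : 0 < Real.sqrt (1 - m * Real.sin s ^ 2) := Real.sqrt_pos.2 (by linarith [hy.2])
    gcongr
    exact sqrt_one_sub_mul_sin_sq_le hm hs.2

lemma exists_le_quarterPeriod (ha : 0 < a) (hb0 : 0 < b) (hb1 : b < 1) (τ : ℝ) :
    ∃ m ∈ Ico (0 : ℝ) 1, τ ≤ quarterPeriod a b m := by
  have hI := geometricConstant_pos ha hb0 hb1
  set K := |τ| / geometricConstant a b
  have hK : 0 ≤ K := by positivity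
  have he1 : Real.exp (-K) ≤ 1 := Real.exp_le_one_iff.2 (by linarith)
  have he0 := Real.exp_pos (-K)
  -- This modulus has `√(1 - m) = exp (-K)`, so the logarithmic bound equals `|τ|`.
  have hm : 1 - Real.exp (-K) ^ 2 ∈ Ico (0 : ℝ) 1 := ⟨by nlinarith, by nlinarith⟩
  refine ⟨_, hm, le_trans ?_ (geometricConstant_mul_log_le_quarterPeriod ha hb0 hb1 hm)⟩
  rw [sub_sub_cancel, Real.sqrt_sq he0.le, Real.log_exp, neg_neg, mul_div_cancel₀ _ hI.ne']
  exact le_abs_self τ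

lemma exists_quarterPeriod_eq (ha : 0 < a) (hb0 : 0 < b) (hb1 : b < 1) {τ : ℝ}
    (hτ : geometricConstant a b * (Real.pi / 2) < τ) :
    ∃ m ∈ Ioo (0 : ℝ) 1, quarterPeriod a b m = τ := by
  obtain ⟨M, hM, hτM⟩ := exists_le_quarterPeriod ha hb0 hb1 τ
  have hsub : Icc 0 M ⊆ Ico (0 : ℝ) 1 := fun x hx => ⟨hx.1, hx.2.trans_lt hM.2⟩
  obtain ⟨m, hm, rfl⟩ := intermediate_value_Icc hM.1
    ((continuousOn_quarterPeriod ha hb0).mono hsub)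
    (show τ ∈ Icc _ _ from ⟨by rw [quarterPeriod_zero hb0]; exact hτ.le, hτM⟩)
  refine ⟨m, ⟨lt_of_le_of_ne hm.1 ?_, hm.2.trans_lt hM.2⟩, rfl⟩
  rintro rfl
  rw [quarterPeriod_zero hb0] at hτ
  exact hτ.false

end QuarterPeriod

/-! ### Uniqueness of trajectories and the admissible levels. -/

/-- Two solutions on a compact interval of an autonomous `C¹` differential equation are equal if
they meet. -/
lemma eqOn_Icc_of_hasDerivWithinAt_of_contDiff {E : Type*} [NormedAddCommGroup E]
    [NormedSpace ℝ E] [ProperSpace E] {v : E → E} (hv : ContDiff ℝ 1 v) {f g : ℝ → E} {l r t₀ : ℝ}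
    (hf : ∀ t ∈ Icc l r, HasDerivWithinAt f (v (f t)) (Icc l r) t)
    (hg : ∀ t ∈ Icc l r, HasDerivWithinAt g (v (g t)) (Icc l r) t)
    (ht₀ : t₀ ∈ Icc l r) (h : f t₀ = g t₀) : EqOn f g (Icc l r) := by
  have hfc : ContinuousOn f (Icc l r) := fun t ht => (hf t ht).continuousWithinAt
  have hgc : ContinuousOn g (Icc l r) := fun t ht => (hg t ht).continuousWithinAt
  -- The field is Lipschitz on bounded sets only; both compact trajectories lie in one ball.
  obtain ⟨R, hR⟩ := ((isCompact_Icc.image_of_continuousOn hfc).union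
    (isCompact_Icc.image_of_continuousOn hgc)).isBounded.subset_closedBall 0
  have hfs : ∀ t ∈ Icc l r, f t ∈ Metric.closedBall (0 : E) R :=
    fun t ht => hR (Or.inl (mem_image_of_mem f ht))
  have hgs : ∀ t ∈ Icc l r, g t ∈ Metric.closedBall (0 : E) R :=
    fun t ht => hR (Or.inr (mem_image_of_mem g ht))
  obtain ⟨K, hK⟩ := hv.contDiffOn.exists_lipschitzOnWith one_ne_zero
    (convex_closedBall (0 : E) R) (isCompact_closedBall 0 R)
  have hle : ∀ {w : ℝ → E}, (∀ t ∈ Icc l r, HasDerivWithinAt w (v (w t)) (Icc l r) t) →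
      ∀ t ∈ Ioc l t₀, HasDerivWithinAt w (v (w t)) (Iic t) t := fun hw t ht =>
    (hw t ⟨ht.1.le, ht.2.trans ht₀.2⟩).mono_of_mem_nhdsWithin
      (mem_of_superset (Icc_mem_nhdsLE ht.1) (Icc_subset_Icc_right (ht.2.trans ht₀.2)))
  have hge : ∀ {w : ℝ → E}, (∀ t ∈ Icc l r, HasDerivWithinAt w (v (w t)) (Icc l r) t) →
      ∀ t ∈ Ico t₀ r, HasDerivWithinAt w (v (w t)) (Ici t) t := fun hw t ht =>
    (hw t ⟨ht₀.1.trans ht.1, ht.2.le⟩).mono_of_mem_nhdsWithin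
      (mem_of_superset (Icc_mem_nhdsGE ht.2) (Icc_subset_Icc_left (ht₀.1.trans ht.1)))
  have hl : Icc l t₀ ⊆ Icc l r := Icc_subset_Icc_right ht₀.2
  have hr : Icc t₀ r ⊆ Icc l r := Icc_subset_Icc_left ht₀.1
  rw [← Icc_union_Icc_eq_Icc ht₀.1 ht₀.2]
  exact (ODE_solution_unique_of_mem_Icc_left (v := fun _ => v) (fun _ _ => hK) (hfc.mono hl)
    (hle hf) (fun t ht => hfs t (hl (Ioc_subset_Icc_self ht))) (hgc.mono hl) (hle hg)
    (fun t ht => hgs t (hl (Ioc_subset_Icc_self ht))) h).union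
    (ODE_solution_unique_of_mem_Icc_right (v := fun _ => v) (fun _ _ => hK) (hfc.mono hr)
    (hge hf) (fun t ht => hfs t (hr (Ico_subset_Icc_self ht))) (hgc.mono hr) (hge hg)
    (fun t ht => hgs t (hr (Ico_subset_Icc_self ht))) h)

/-- The vector field of the reduced system in the variables `(ψ, cos θ)`. -/
noncomputable def phaseField (a b : ℝ) (p : ℝ × ℝ) : ℝ × ℝ :=
  ((a + b * Real.cos p.1 ^ 2) * p.2 / (1 - b * Real.cos p.1 ^ 2),
    -(b * (1 - p.2 ^ 2) * Real.sin p.1 * Real.cos p.1 / (1 - b * Real.cos p.1 ^ 2)))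

lemma one_sub_mul_cos_sq_pos {b : ℝ} (hb0 : 0 < b) (hb1 : b < 1) (x : ℝ) :
    0 < 1 - b * Real.cos x ^ 2 := by
  nlinarith [Real.cos_sq_le_one x]

lemma contDiff_phaseField {a b : ℝ} (hb0 : 0 < b) (hb1 : b < 1) :
    ContDiff ℝ 1 (phaseField a b) := by
  have h : ∀ p : ℝ × ℝ, 1 - b * Real.cos p.1 ^ 2 ≠ 0 :=
    fun p => (one_sub_mul_cos_sq_pos hb0 hb1 p.1).ne'
  unfold phaseField
  have hc : ContDiff ℝ 1 fun p : ℝ × ℝ => Real.cos p.1 := Real.contDiff_cos.comp contDiff_fst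
  have hs : ContDiff ℝ 1 fun p : ℝ × ℝ => Real.sin p.1 := Real.contDiff_sin.comp contDiff_fst
  have hd : ContDiff ℝ 1 fun p : ℝ × ℝ => 1 - b * Real.cos p.1 ^ 2 := by fun_prop
  exact (ContDiff.div (by fun_prop) hd h).prodMk (ContDiff.div (by fun_prop) hd h).neg

/-- The derivative of `cos θ` involves `θ` only through `sin² θ`, so the system closes in `(ψ, cos
θ)`. This matters because the level determines `cos θ(0)` but not `θ(0)`. -/
lemma IsReducedSolution.hasDerivWithinAt_phaseField {a b : ℝ} {ψ θ : ℝ → ℝ}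
    (h : IsReducedSolution a b ψ θ) : ∀ t ∈ Icc (-Real.pi) Real.pi,
    HasDerivWithinAt (fun t => (ψ t, Real.cos (θ t))) (phaseField a b (ψ t, Real.cos (θ t)))
      (Icc (-Real.pi) Real.pi) t := by
  intro t ht
  refine (h t ht).1.prodMk ((h t ht).2.cos.congr_deriv ?_)
  simp only [← Real.sin_sq]
  ring

/-- Solutions for which `ψ` and `cos θ` agree at one time have the same `ψ` and `cos θ`. -/
lemma IsReducedSolution.eqOn {a b : ℝ} (hb0 : 0 < b) (hb1 : b < 1) {ψ θ ψ' θ' : ℝ → ℝ}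
    (h : IsReducedSolution a b ψ θ) (h' : IsReducedSolution a b ψ' θ') {t₀ : ℝ}
    (ht₀ : t₀ ∈ Icc (-Real.pi) Real.pi) (hψ : ψ t₀ = ψ' t₀)
    (hθ : Real.cos (θ t₀) = Real.cos (θ' t₀)) : EqOn ψ ψ' (Icc (-Real.pi) Real.pi) := by
  have := eqOn_Icc_of_hasDerivWithinAt_of_contDiff (contDiff_phaseField hb0 hb1)
    h.hasDerivWithinAt_phaseField h'.hasDerivWithinAt_phaseField ht₀ (Prod.ext hψ hθ)
  exact fun t ht => congrArg Prod.fst (this ht)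

lemma firstIntegral_eq_iff {a b c ψ θ : ℝ} : firstIntegral a b ψ θ = c ↔
    Real.cos θ ^ 2 * (a + b * Real.cos ψ ^ 2) = c + b * Real.cos ψ ^ 2 := by
  rw [firstIntegral, Real.sin_sq]
  constructor <;> intro h <;> linarith

lemma zero_mem_Icc_neg_pi_pi : (0 : ℝ) ∈ Icc (-Real.pi) Real.pi :=
  ⟨by linarith [Real.pi_pos], Real.pi_pos.le⟩

lemma pi_mem_Icc_neg_pi_pi : Real.pi ∈ Icc (-Real.pi) Real.pi :=
  ⟨by linarith [Real.pi_pos], le_rfl⟩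

/-- `𝓒` is the graph of a function of `c`. -/
lemma injOn_fst_curveC {a b : ℝ} (ha : 0 < a) (hb0 : 0 < b) (hb1 : b < 1) :
    InjOn Prod.fst (curveC a b) := by
  rintro ⟨c, ε⟩ ⟨ψ, θ, h, hI, -, hε, h0, hθ⟩ ⟨c', ε'⟩ ⟨ψ', θ', h', hI', -, hε', h0', hθ'⟩
    (rfl : c = c')
  have e := firstIntegral_eq_iff.1 (hI 0 zero_mem_Icc_neg_pi_pi)
  have e' := firstIntegral_eq_iff.1 (hI' 0 zero_mem_Icc_neg_pi_pi)
  rw [h0] at e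
  rw [h0', ← e] at e'
  simp only [Real.cos_zero, one_pow, mul_one] at e'
  have hcos : Real.cos (θ 0) = Real.cos (θ' 0) :=
    (sq_eq_sq₀ hθ.le hθ'.le).1 (mul_right_cancel₀ (by positivity) e').symm
  have := h.eqOn hb0 hb1 h' zero_mem_Icc_neg_pi_pi (h0.trans h0'.symm) hcos pi_mem_Icc_neg_pi_pi
  simp only at hε hε'
  exact Prod.ext rfl (by simp only; linarith)

lemma neg_lt_fst_of_mem_curveC {a b : ℝ} (ha : 0 < a) (hb0 : 0 < b) {p : ℝ × ℝ}
    (hp : p ∈ curveC a b) : -b < p.1 := by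
  obtain ⟨ψ, θ, -, hI, -, -, h0, hθ⟩ := hp
  have e := firstIntegral_eq_iff.1 (hI 0 zero_mem_Icc_neg_pi_pi)
  rw [h0, Real.cos_zero] at e
  have : 0 < Real.cos (θ 0) ^ 2 * (a + b * 1 ^ 2) := by positivity
  linarith

/-- On `𝓢` one has `c ≤ 0`, and `c = 0` would put the end point at an equilibrium `cos ψ = cos θ =
0`. By uniqueness `ψ` would be constant, against `ψ 0 = 0`. -/
lemma fst_neg_of_mem_curveC_inter_curveS {a b : ℝ} (ha : 0 < a) (hb0 : 0 < b) (hb1 : b < 1)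
    {p : ℝ × ℝ} (hp : p ∈ curveC a b ∩ curveS b) : p.1 < 0 := by
  obtain ⟨⟨ψ, θ, h, hI, -, hε, h0, hθ⟩, hS⟩ := hp
  have hS : p.1 = -b * Real.sin p.2 ^ 2 := hS
  refine lt_of_le_of_ne (by rw [hS]; nlinarith [sq_nonneg (Real.sin p.2)]) fun hc => ?_
  have hcosψ : Real.cos (ψ Real.pi) = 0 := by
    rw [hε, Real.cos_pi_div_two_sub]
    rw [hc] at hS
    simpa [hb0.ne'] using hS.symm
  have e := firstIntegral_eq_iff.1 (hI Real.pi pi_mem_Icc_neg_pi_pi)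
  have hcosθ : Real.cos (θ Real.pi) = 0 := by
    simpa [hcosψ, hc, ha.ne'] using e
  have heq : IsReducedSolution a b (fun _ => ψ Real.pi) (fun _ => θ Real.pi) := fun t _ => by
    simp only [hcosψ, hcosθ, mul_zero, zero_div]
    exact ⟨hasDerivWithinAt_const .., hasDerivWithinAt_const ..⟩
  have := h.eqOn hb0 hb1 heq pi_mem_Icc_neg_pi_pi rfl rfl zero_mem_Icc_neg_pi_pi
  simp only [h0] at this
  rw [← this, Real.cos_zero] at hcosψ
  exact one_ne_zero hcosψ

/-! ### Explicit oscillating solutions. -/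

section Oscillation

variable {a b m : ℝ}

/-- The angle `ψ` at phase `u` of the oscillation with modulus `m`. -/
noncomputable def oscPsi (m u : ℝ) : ℝ :=
  Real.arcsin (Real.sqrt m * Real.sin u)

/-- The value of `cos θ` at phase `u` of the oscillation with modulus `m`. -/
noncomputable def oscCos (a b m u : ℝ) : ℝ :=
  Real.sqrt (b * m) * Real.cos u / Real.sqrt (a + b - b * (m * Real.sin u ^ 2))

lemma oscPsi_zero : oscPsi m 0 = 0 := by simp [oscPsi]

lemma oscPsi_neg (u : ℝ) : oscPsi m (-u) = -oscPsi m u := by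
  simp [oscPsi]

lemma abs_sqrt_mul_sin_lt_one (hm : m ∈ Ico (0 : ℝ) 1) (u : ℝ) :
    |Real.sqrt m * Real.sin u| < 1 := by
  rw [← sq_lt_one_iff_abs_lt_one, mul_pow, Real.sq_sqrt hm.1]
  exact (mul_sin_sq_mem_Ico hm u).2

lemma sin_oscPsi (hm : m ∈ Ico (0 : ℝ) 1) (u : ℝ) :
    Real.sin (oscPsi m u) = Real.sqrt m * Real.sin u :=
  have h := abs_lt.1 (abs_sqrt_mul_sin_lt_one hm u)
  Real.sin_arcsin h.1.le h.2.le

lemma cos_oscPsi (hm : m ∈ Ico (0 : ℝ) 1) (u : ℝ) :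
    Real.cos (oscPsi m u) = Real.sqrt (1 - m * Real.sin u ^ 2) := by
  rw [oscPsi, Real.cos_arcsin, mul_pow, Real.sq_sqrt hm.1]

lemma cos_oscPsi_sq (hm : m ∈ Ico (0 : ℝ) 1) (u : ℝ) :
    Real.cos (oscPsi m u) ^ 2 = 1 - m * Real.sin u ^ 2 := by
  rw [cos_oscPsi hm, Real.sq_sqrt (by linarith [(mul_sin_sq_mem_Ico hm u).2])]

lemma oscDenom_pos (ha : 0 < a) (hb0 : 0 < b) (hm : m ∈ Ico (0 : ℝ) 1) (u : ℝ) :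
    0 < a + b - b * (m * Real.sin u ^ 2) := by
  nlinarith [(mul_sin_sq_mem_Ico hm u).2]

lemma oscCos_sq (ha : 0 < a) (hb0 : 0 < b) (hm : m ∈ Ico (0 : ℝ) 1) (u : ℝ) :
    oscCos a b m u ^ 2 = b * m * Real.cos u ^ 2 / (a + b - b * (m * Real.sin u ^ 2)) := by
  rw [oscCos, div_pow, mul_pow, Real.sq_sqrt (mul_nonneg hb0.le hm.1),
    Real.sq_sqrt (oscDenom_pos ha hb0 hm u).le]

lemma one_sub_oscCos_sq (ha : 0 < a) (hb0 : 0 < b) (hm : m ∈ Ico (0 : ℝ) 1) (u : ℝ) :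
    1 - oscCos a b m u ^ 2 = (a + b - b * m) / (a + b - b * (m * Real.sin u ^ 2)) := by
  have h := (oscDenom_pos ha hb0 hm u).ne'
  rw [oscCos_sq ha hb0 hm, Real.cos_sq', eq_div_iff h, sub_mul, div_mul_cancel₀ _ h]
  ring

lemma one_sub_oscCos_sq_pos (ha : 0 < a) (hb0 : 0 < b) (hm : m ∈ Ico (0 : ℝ) 1) (u : ℝ) :
    0 < 1 - oscCos a b m u ^ 2 := by
  rw [one_sub_oscCos_sq ha hb0 hm]
  exact div_pos (by nlinarith [hm.2]) (oscDenom_pos ha hb0 hm u)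

lemma hasDerivAt_oscPsi (hm : m ∈ Ico (0 : ℝ) 1) (u : ℝ) :
    HasDerivAt (oscPsi m) (Real.sqrt m * Real.cos u / Real.sqrt (1 - m * Real.sin u ^ 2)) u := by
  have h := abs_lt.1 (abs_sqrt_mul_sin_lt_one hm u)
  refine ((Real.hasDerivAt_arcsin h.1.ne' h.2.ne).comp u
    ((Real.hasDerivAt_sin u).const_mul (Real.sqrt m))).congr_deriv ?_
  rw [mul_pow, Real.sq_sqrt hm.1]
  ring

lemma hasDerivAt_oscCos (ha : 0 < a) (hb0 : 0 < b) (hm : m ∈ Ico (0 : ℝ) 1) (u : ℝ) :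
    HasDerivAt (oscCos a b m)
      (-(Real.sqrt (b * m) * Real.sin u * (1 - oscCos a b m u ^ 2) /
        Real.sqrt (a + b - b * (m * Real.sin u ^ 2)))) u := by
  have hA := oscDenom_pos ha hb0 hm u
  have hd : HasDerivAt (fun u => a + b - b * (m * Real.sin u ^ 2))
      (-(b * (m * (2 * Real.sin u * Real.cos u)))) u := by
    simpa using ((((Real.hasDerivAt_sin u).pow 2).const_mul m).const_mul b).const_sub (a + b)
  refine (((Real.hasDerivAt_cos u).const_mul (Real.sqrt (b * m))).div (hd.sqrt hA.ne')
    (Real.sqrt_pos.2 hA).ne').congr_deriv ?_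
  rw [oscCos_sq ha hb0 hm]
  have hsq := Real.sq_sqrt hA.le
  have hr := Real.sqrt_pos.2 hA
  set A := a + b - b * (m * Real.sin u ^ 2)
  set r := Real.sqrt A
  rw [← hsq]
  field_simp
  ring

/-- The oscillation with modulus `m`, run through with phase `u`, solves the reduced equations. -/
lemma isReducedSolution_oscillation (ha : 0 < a) (hb0 : 0 < b) (hb1 : b < 1)
    (hm : m ∈ Ico (0 : ℝ) 1) {u : ℝ → ℝ}
    (hu : ∀ t, HasDerivAt u (timeDensity a b (m * Real.sin (u t) ^ 2))⁻¹ t) :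
    IsReducedSolution a b (fun t => oscPsi m (u t))
      (fun t => Real.arccos (oscCos a b m (u t))) := by
  intro t _
  have hA := oscDenom_pos ha hb0 hm (u t)
  have hy := mul_sin_sq_mem_Ico hm (u t)
  have hD : 0 < 1 - m * Real.sin (u t) ^ 2 := by linarith [hy.2]
  have hx := one_sub_oscCos_sq_pos ha hb0 hm (u t)
  have hx1 : |oscCos a b m (u t)| < 1 := by
    rw [← sq_lt_one_iff_abs_lt_one]
    linarith
  obtain ⟨hx1, hx2⟩ := abs_lt.1 hx1
  have hN : 0 < 1 - b + b * (m * Real.sin (u t) ^ 2) := by nlinarith [hy.1]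
  have hN' : 1 - b * (1 - m * Real.sin (u t) ^ 2) = 1 - b + b * (m * Real.sin (u t) ^ 2) := by
    ring
  have hA' : a + b * (1 - m * Real.sin (u t) ^ 2) = a + b - b * (m * Real.sin (u t) ^ 2) := by
    ring
  have hsA := Real.sqrt_pos.2 hA
  have hsD := Real.sqrt_pos.2 hD
  have hsb := Real.sqrt_pos.2 hb0
  have hsA2 := Real.sq_sqrt hA.le
  have hsb2 := Real.sq_sqrt hb0.le
  have hsx2 := Real.sq_sqrt hx.le
  have hsx := Real.sqrt_pos.2 hx
  have hψ := (hasDerivAt_oscPsi hm (u t)).comp t (hu t)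
  have hθ := (Real.hasDerivAt_arccos hx1.ne' hx2.ne).comp t
    ((hasDerivAt_oscCos ha hb0 hm (u t)).comp t (hu t))
  refine ⟨(hψ.congr_deriv ?_).hasDerivWithinAt, (hθ.congr_deriv ?_).hasDerivWithinAt⟩
  · rw [Real.cos_arccos hx1.le hx2.le, cos_oscPsi_sq hm, hN', hA', timeDensity, oscCos,
      Real.sqrt_mul hb0.le]
    set A := a + b - b * (m * Real.sin (u t) ^ 2)
    set r := Real.sqrt A
    -- With `A` written as `r ^ 2` the identity is algebraic in the square roots.
    rw [← hsA2]
    field_simp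
  · rw [Real.sin_arccos, cos_oscPsi_sq hm, hN', sin_oscPsi hm, cos_oscPsi hm, timeDensity,
      Real.sqrt_mul hb0.le]
    set q := Real.sqrt (1 - oscCos a b m (u t) ^ 2)
    set A := a + b - b * (m * Real.sin (u t) ^ 2)
    set D := 1 - m * Real.sin (u t) ^ 2
    rw [← hsx2]
    field_simp
    rw [hsb2]
    ring

lemma firstIntegral_oscillation (ha : 0 < a) (hb0 : 0 < b) (hm : m ∈ Ico (0 : ℝ) 1) (u : ℝ) :
    firstIntegral a b (oscPsi m u) (Real.arccos (oscCos a b m u)) = b * (m - 1) := by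
  have hA := (oscDenom_pos ha hb0 hm u).ne'
  rw [firstIntegral, Real.sin_arccos, Real.sq_sqrt (one_sub_oscCos_sq_pos ha hb0 hm u).le,
    one_sub_oscCos_sq ha hb0 hm, cos_oscPsi_sq hm]
  rw [show a + b * (1 - m * Real.sin u ^ 2) = a + b - b * (m * Real.sin u ^ 2) by ring,
    div_mul_cancel₀ _ hA]
  ring

/-- The point of `𝓒` on the level of the oscillation with modulus `m`, with the time-parametrized
phase `u`. -/
lemma mem_curveC_oscillation (ha : 0 < a) (hb0 : 0 < b) (hb1 : b < 1)
    (hm : m ∈ Ioo (0 : ℝ) 1) {u : ℝ → ℝ} (hu0 : u 0 = 0) (hneg : ∀ t, u (-t) = -u t)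
    (hu : ∀ t, HasDerivAt u (timeDensity a b (m * Real.sin (u t) ^ 2))⁻¹ t) :
    (b * (m - 1), Real.pi / 2 - oscPsi m (u Real.pi)) ∈ curveC a b := by
  have hm' := Ioo_subset_Ico_self hm
  refine ⟨_, _, isReducedSolution_oscillation ha hb0 hb1 hm' hu,
    fun t _ => firstIntegral_oscillation ha hb0 hm' (u t), ?_, ?_, ?_, ?_⟩
  · simp only [hneg, oscPsi_neg]
    ring
  · simp
  · simp [hu0, oscPsi_zero]
  · have hx := one_sub_oscCos_sq_pos ha hb0 hm' (u 0)
    have hx1 := abs_lt.1 ((sq_lt_one_iff_abs_lt_one _).1 (by linarith : oscCos a b m (u 0) ^ 2 < 1))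
    rw [Real.cos_arccos hx1.1.le hx1.2.le, hu0, oscCos]
    have := hm.1
    have hA := oscDenom_pos ha hb0 hm' 0
    have : 0 < Real.sqrt (b * m) := Real.sqrt_pos.2 (by positivity)
    rw [Real.cos_zero]
    positivity

/-- The modulus `m` is that of an intersection point iff a turning point is reached at time `π`. -/
lemma exists_mem_inter_iff (ha : 0 < a) (hb0 : 0 < b) (hb1 : b < 1) (hm : m ∈ Ioo (0 : ℝ) 1) :
    (∃ ε, (b * (m - 1), ε) ∈ curveC a b ∩ curveS b) ↔
      ∃ j : ℕ, (2 * j + 1) * quarterPeriod a b m = Real.pi := by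
  have hm' := Ioo_subset_Ico_self hm
  obtain ⟨u, hG, hu0, hneg, hu⟩ := exists_phase ha hb0 hb1 hm'
  have hC := mem_curveC_oscillation ha hb0 hb1 hm hu0 hneg hu
  have hmono := strictMono_phaseTime ha hb0 hb1 hm'
  have hS : (b * (m - 1), Real.pi / 2 - oscPsi m (u Real.pi)) ∈ curveS b ↔
      Real.cos (u Real.pi) = 0 := by
    simp only [curveS, mem_ofPred_eq, Real.sin_pi_div_two_sub, cos_oscPsi_sq hm']
    have hbm : b * m ≠ 0 := (mul_pos hb0 hm.1).ne'
    -- The defect in the equation of `𝓢` is `b m cos² u(π)`, which vanishes exactly at turning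
    -- points.
    have h : b * m * Real.cos (u Real.pi) ^ 2 =
        b * (m - 1) - -b * (1 - m * Real.sin (u Real.pi) ^ 2) := by
      rw [Real.cos_sq']
      ring
    rw [← sub_eq_zero, ← h, mul_eq_zero, or_iff_right hbm, sq_eq_zero_iff]
  have hu : (∃ ε, (b * (m - 1), ε) ∈ curveC a b ∩ curveS b) ↔ Real.cos (u Real.pi) = 0 := by
    rw [← hS]
    refine ⟨fun ⟨ε, hε⟩ => ?_, fun h => ⟨_, hC, h⟩⟩
    rw [← injOn_fst_curveC ha hb0 hb1 hε.1 hC rfl]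
    exact hε.2
  rw [hu]
  have key : ∀ j : ℕ, phaseTime a b m (Real.pi / 2 + j * Real.pi) =
      (2 * j + 1) * quarterPeriod a b m := fun j => by
    rw [phaseTime_add_nat_mul_pi ha hb0 hm', ← quarterPeriod]
    ring
  constructor
  · intro h
    obtain ⟨k, hk⟩ := Real.cos_eq_zero_iff.1 h
    have hupos : 0 < u Real.pi := by
      rw [← hmono.lt_iff_lt, hG, phaseTime_zero]
      exact Real.pi_pos
    have hk0 : 0 ≤ k := by
      by_contra! hlt
      have : (k : ℝ) ≤ -1 := by exact_mod_cast Int.le_sub_one_of_lt hlt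
      nlinarith [Real.pi_pos]
    lift k to ℕ using hk0
    have e : u Real.pi = Real.pi / 2 + k * Real.pi := by
      rw [hk]
      push_cast
      ring
    exact ⟨k, by rw [← key, ← e, hG]⟩
  · rintro ⟨j, hj⟩
    have : u Real.pi = Real.pi / 2 + j * Real.pi := hmono.injective (by rw [hG, key, hj])
    rw [this, Real.cos_add_nat_mul_pi, Real.cos_pi_div_two, mul_zero]

/-- After `j` half periods the phase is `j π`, so `ψ` is back at `0`. -/
lemma mem_curveC_pi_div_two (ha : 0 < a) (hb0 : 0 < b) (hb1 : b < 1) (hm : m ∈ Ioo (0 : ℝ) 1)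
    {j : ℕ} (hj : 2 * j * quarterPeriod a b m = Real.pi) :
    (b * (m - 1), Real.pi / 2) ∈ curveC a b := by
  have hm' := Ioo_subset_Ico_self hm
  obtain ⟨u, hG, hu0, hneg, hu⟩ := exists_phase ha hb0 hb1 hm'
  have hC := mem_curveC_oscillation ha hb0 hb1 hm hu0 hneg hu
  have hmono := strictMono_phaseTime ha hb0 hb1 hm'
  have h := phaseTime_add_nat_mul_pi ha hb0 hm' 0 j
  rw [phaseTime_zero, zero_add, zero_add, hj] at h
  have hupi : u Real.pi = j * Real.pi := hmono.injective (by rw [hG, h])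
  simpa [hupi, oscPsi, Real.sin_nat_mul_pi] using hC

/-- The intersection points lie on the levels of oscillations. -/
lemma exists_modulus_of_mem_inter (ha : 0 < a) (hb0 : 0 < b) (hb1 : b < 1) {p : ℝ × ℝ}
    (hp : p ∈ curveC a b ∩ curveS b) : ∃ m ∈ Ioo (0 : ℝ) 1, p.1 = b * (m - 1) ∧
      ∃ j : ℕ, (2 * j + 1) * quarterPeriod a b m = Real.pi := by
  have h1 := neg_lt_fst_of_mem_curveC ha hb0 hp.1
  have h2 := fst_neg_of_mem_curveC_inter_curveS ha hb0 hb1 hp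
  have hm : (p.1 + b) / b ∈ Ioo (0 : ℝ) 1 :=
    ⟨div_pos (by linarith) hb0, (div_lt_one hb0).2 (by linarith)⟩
  have hp1 : p.1 = b * ((p.1 + b) / b - 1) := by
    field_simp
    ring
  refine ⟨_, hm, hp1, (exists_mem_inter_iff ha hb0 hb1 hm).1 ⟨p.2, ?_⟩⟩
  rw [← hp1]
  exact hp

end Oscillation

/-! ### Counting the intersection points. -/

section Intersections

variable {a b : ℝ}

/-- If the `j`-th candidate value of the quarter period is above the limit of small oscillations,
there is a point of `𝓒` and `𝓢` at which the quarter period takes this value. -/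
lemma exists_mem_inter_of_lt (ha : 0 < a) (hb0 : 0 < b) (hb1 : b < 1) {j : ℕ}
    (hj : geometricConstant a b * (Real.pi / 2) < Real.pi / (2 * j + 1)) :
    ∃ m ∈ Ioo (0 : ℝ) 1, quarterPeriod a b m = Real.pi / (2 * j + 1) ∧
      ∃ ε, (b * (m - 1), ε) ∈ curveC a b ∩ curveS b := by
  obtain ⟨m, hm, hq⟩ := exists_quarterPeriod_eq ha hb0 hb1 hj
  refine ⟨m, hm, hq, (exists_mem_inter_iff ha hb0 hb1 hm).2 ⟨j, ?_⟩⟩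
  rw [hq]
  field_simp

lemma lt_quarterPeriod (ha : 0 < a) (hb0 : 0 < b) (hb1 : b < 1) {m : ℝ} (hm : m ∈ Ioo (0 : ℝ) 1) :
    geometricConstant a b * (Real.pi / 2) < quarterPeriod a b m := by
  rw [← quarterPeriod_zero hb0]
  exact strictMonoOn_quarterPeriod ha hb0 hb1 (by simp) (Ioo_subset_Ico_self hm) hm.1

/-- Both sides increase with the modulus, so ordering by `c` is ordering by quarter period. -/
lemma fst_lt_fst_iff (ha : 0 < a) (hb0 : 0 < b) (hb1 : b < 1) {m m' : ℝ}
    (hm : m ∈ Ioo (0 : ℝ) 1) (hm' : m' ∈ Ioo (0 : ℝ) 1) :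
    b * (m - 1) < b * (m' - 1) ↔ quarterPeriod a b m < quarterPeriod a b m' := by
  rw [(strictMonoOn_quarterPeriod ha hb0 hb1).lt_iff_lt (Ioo_subset_Ico_self hm)
    (Ioo_subset_Ico_self hm'), mul_lt_mul_iff_right₀ hb0, sub_lt_sub_iff_right]

/-- The points above the one whose quarter period is `π / (2 j + 1)` are `j + 1` in number. -/
lemma encard_inter_ge (ha : 0 < a) (hb0 : 0 < b) (hb1 : b < 1) {m : ℝ} (hm : m ∈ Ioo (0 : ℝ) 1)
    {j : ℕ} (hj : quarterPeriod a b m = Real.pi / (2 * j + 1)) :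
    {q | q ∈ curveC a b ∩ curveS b ∧ b * (m - 1) ≤ q.1}.encard = (j + 1 : ℕ) := by
  have hpi := Real.pi_pos
  have hI := hj ▸ lt_quarterPeriod ha hb0 hb1 hm
  -- Every `i ≤ j` is admissible, as `π / (2 i + 1) ≥ π / (2 j + 1)`.
  have hex : ∀ i : Fin (j + 1), ∃ p : ℝ × ℝ, p ∈ curveC a b ∩ curveS b ∧
      ∃ m ∈ Ioo (0 : ℝ) 1, p.1 = b * (m - 1) ∧
        quarterPeriod a b m = Real.pi / (2 * (i : ℕ) + 1) := fun i => by
    have hi : ((i : ℕ) : ℝ) ≤ j := by exact_mod_cast Nat.lt_succ_iff.1 i.2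
    obtain ⟨m', hm', hq, ε, hε⟩ := exists_mem_inter_of_lt ha hb0 hb1 (j := i)
      (hI.trans_le (by gcongr))
    exact ⟨_, hε, m', hm', rfl, hq⟩
  choose P hP M hM hPM hQ using hex
  have hinj : Function.Injective P := fun i i' h => by
    have hMM : M i = M i' := by
      have := congrArg Prod.fst h
      rw [hPM, hPM, mul_right_inj' hb0.ne'] at this
      linarith
    have h1 := hQ i
    rw [hMM, hQ i', div_eq_div_iff (by positivity) (by positivity), mul_right_inj' hpi.ne'] at h1
    have h2 : ((i : ℕ) : ℝ) = (i' : ℕ) := by linarith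
    exact Fin.ext (by exact_mod_cast h2)
  have hrange : {q | q ∈ curveC a b ∩ curveS b ∧ b * (m - 1) ≤ q.1} = range P := by
    ext q
    constructor
    · rintro ⟨hq, hle⟩
      obtain ⟨m', hm', hq1, i, hi⟩ := exists_modulus_of_mem_inter ha hb0 hb1 hq
      have hi' : quarterPeriod a b m' = Real.pi / (2 * i + 1) := by
        rw [eq_div_iff (by positivity), mul_comm, hi]
      rw [hq1, ← not_lt, fst_lt_fst_iff ha hb0 hb1 hm' hm, not_lt, hj, hi',
        div_le_div_iff_of_pos_left hpi (by positivity) (by positivity)] at hle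
      have hij : (i : ℝ) ≤ j := by linarith
      have hij : i < j + 1 := Nat.lt_succ_iff.2 (by exact_mod_cast hij)
      refine ⟨⟨i, hij⟩, injOn_fst_curveC ha hb0 hb1 (hP _).1 hq.1 ?_⟩
      have : M ⟨i, hij⟩ = m' := (strictMonoOn_quarterPeriod ha hb0 hb1).injOn
        (Ioo_subset_Ico_self (hM _)) (Ioo_subset_Ico_self hm') (by rw [hQ, hi'])
      rw [hPM, hq1, this]
    · rintro ⟨i, rfl⟩
      have hi : ((i : ℕ) : ℝ) ≤ j := by exact_mod_cast Nat.lt_succ_iff.1 i.2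
      refine ⟨hP i, ?_⟩
      rw [hPM, ← not_lt, fst_lt_fst_iff ha hb0 hb1 (hM i) hm, not_lt, hj, hQ]
      gcongr
  rw [hrange, ← image_univ, hinj.encard_image, encard_univ, ENat.card_eq_coe_fintype_card,
    Fintype.card_fin]

end Intersections

end TennisRacket

open TennisRacket in
theorem mainTheorem4 (a b : ℝ) (ha : 0 < a) (hb0 : 0 < b) (hb1 : b < 1) (n : ℕ) (hn : 1 ≤ n)
    (hI : TennisRacket.geometricConstant a b < 2 / (2 * (n : ℝ) + 1)) :
    (n : ℕ∞) ≤ (TennisRacket.curveC a b ∩ TennisRacket.curveS b).encard ∧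
    (∃ p : ℝ × ℝ, TennisRacket.IsNthIntersection a b n p) ∧
    ∀ p : ℝ × ℝ, TennisRacket.IsNthIntersection a b n p →
      (∃ c ∈ Set.Ioo (-b) p.1, (c, Real.pi / 2) ∈ TennisRacket.curveC a b) ∧
      (∃ q ∈ TennisRacket.curveC a b ∩ TennisRacket.curveS b, q.1 ∈ Set.Ioo (-b) p.1) := by
  have hpi := Real.pi_pos
  have hlim : geometricConstant a b * (Real.pi / 2) < Real.pi / (2 * n + 1) := by
    calc _ < 2 / (2 * (n : ℝ) + 1) * (Real.pi / 2) := by gcongr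
      _ = Real.pi / (2 * n + 1) := by ring
  -- The indices `j` start at `0`, so the `n`-th point has index `k = n - 1`.
  obtain ⟨k, rfl⟩ := Nat.exists_eq_add_of_le' hn
  push_cast at hlim
  have hnth : ∃ p : ℝ × ℝ, IsNthIntersection a b (k + 1) p := by
    obtain ⟨m, hm, hq, ε, hε⟩ := exists_mem_inter_of_lt ha hb0 hb1 (j := k)
      (hlim.trans (by gcongr; linarith))
    exact ⟨_, hε, encard_inter_ge ha hb0 hb1 hm hq⟩
  refine ⟨?_, hnth, fun p ⟨hp, hcard⟩ => ?_⟩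
  · obtain ⟨p, -, hcard⟩ := hnth
    rw [← hcard]
    exact Set.encard_le_encard fun q hq => hq.1
  · obtain ⟨m, hm, hp1, j, hj⟩ := exists_modulus_of_mem_inter ha hb0 hb1 hp
    have hj' : quarterPeriod a b m = Real.pi / (2 * j + 1) := by
      rw [eq_div_iff (by positivity), mul_comm, hj]
    rw [hp1, encard_inter_ge ha hb0 hb1 hm hj'] at hcard
    -- Counting the points at or above `p` identifies its index.
    obtain rfl : j = k := by
      have : j + 1 = k + 1 := by exact_mod_cast hcard
      omega
    constructor
    -- The value `π / (2 n)` lies between `π / (2 n + 1)` and the quarter period `π / (2 n - 1)` of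
    -- `p`.
    · obtain ⟨m', hm', hq⟩ := exists_quarterPeriod_eq ha hb0 hb1
        (τ := Real.pi / (2 * (j + 1 : ℕ))) (hlim.trans (by push_cast; gcongr; linarith))
      have hC := mem_curveC_pi_div_two ha hb0 hb1 hm' (j := j + 1) (by rw [hq]; field_simp)
      refine ⟨_, ⟨neg_lt_fst_of_mem_curveC ha hb0 hC, ?_⟩, hC⟩
      rw [hp1, fst_lt_fst_iff ha hb0 hb1 hm' hm, hq, hj']
      push_cast
      gcongr
      linarith
    -- The next index `j + 1 = n` is admissible exactly by the hypothesis on `𝓘`.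
    · obtain ⟨m', hm', hq, ε, hε⟩ := exists_mem_inter_of_lt ha hb0 hb1 (j := j + 1)
        (by exact_mod_cast hlim)
      refine ⟨_, hε, neg_lt_fst_of_mem_curveC ha hb0 hε.1, ?_⟩
      rw [hp1, fst_lt_fst_iff ha hb0 hb1 hm' hm, hq, hj']
      gcongr
      linarith
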